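/- Let $G$ be an infinite Abelian group, written additively. A paratopological group topology on $G$ is a topology for which addition $G\times G\to G$ is jointly continuous. Let $(a_n)_{n\in\mathbb N}$ be a $T$-sequence in $G$, that is, a sequence that converges to $0$ in some Hausdorff group topology on $G$. Let $P(G|\{a_n\})$ denote $G$ endowed with the strongest (finest) $T_1$ paratopological group topology $\tau$ in which $(a_n)$ converges to $0$; such a strongest topology exists. Two $T_1$ topologies on $G$ are called $T_1$-complementary if their intersection is the cofinite topology on $G$ and their union generates the discrete topology on $G$. Then there is no Hausdorff paratopological group topology $\sigma$ on $G$ such that $\tau$ and $\sigma$ are $T_1$-complementary. -/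

import Mathlib

open Filter Topology

/-- `t` is a Hausdorff topology on the abelian group `G` making `G` a topological group. -/
structure IsHausdorffGroupTopology {G : Type*} [AddCommGroup G] (t : TopologicalSpace G) :
    Prop where
  isTopologicalAddGroup : @IsTopologicalAddGroup G t _
  t2Space : @T2Space G t

/-- `t` is a `T₁` topology on the abelian group `G` making `G` a paratopological group:
addition is jointly continuous, while inversion need not be. -/
structure IsT1ParatopologicalGroupTopology {G : Type*} [AddCommGroup G]
    (t : TopologicalSpace G) : Prop where
  continuousAdd : @ContinuousAdd G t _
  t1Space : @T1Space G t

/-- `t` is a Hausdorff topology on the abelian group `G` making `G` a paratopological group. -/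
structure IsHausdorffParatopologicalGroupTopology {G : Type*} [AddCommGroup G]
    (t : TopologicalSpace G) : Prop where
  continuousAdd : @ContinuousAdd G t _
  t2Space : @T2Space G t

/-- `a` is a `T`-sequence: it converges to `0` in some Hausdorff group topology. -/
def IsTSequence {G : Type*} [AddCommGroup G] (a : ℕ → G) : Prop :=
  ∃ t : TopologicalSpace G, IsHausdorffGroupTopology t ∧ Tendsto a atTop (@nhds G t 0)

/-- `a` is a `PT`-sequence: it converges to `0` in some `T₁` paratopological group topology. -/
def IsPTSequence {G : Type*} [AddCommGroup G] (a : ℕ → G) : Prop :=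
  ∃ t : TopologicalSpace G,
    IsT1ParatopologicalGroupTopology t ∧ Tendsto a atTop (@nhds G t 0)

/-- The `T₁` paratopological group topologies on `G` in which `a` converges to `0`. -/
def convergenceTopologies {G : Type*} [AddCommGroup G] (a : ℕ → G) :
    Set (TopologicalSpace G) :=
  {t | IsT1ParatopologicalGroupTopology t ∧ Tendsto a atTop (@nhds G t 0)}

/-- The topology of `P(G | a)`: the strongest (finest) `T₁` paratopological group topology on `G`
in which `a` converges to `0`. In Mathlib's order on topologies the finer topology is the smaller
one, so this is an infimum; `isLeast_strongestParatopology` shows that it is attained. -/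
def strongestParatopology {G : Type*} [AddCommGroup G] (a : ℕ → G) : TopologicalSpace G :=
  sInf (convergenceTopologies a)

theorem IsTSequence.isPTSequence {G : Type*} [AddCommGroup G] {a : ℕ → G}
    (ha : IsTSequence a) : IsPTSequence a := by
  obtain ⟨t, ht, hconv⟩ := ha
  letI := t
  haveI := ht.isTopologicalAddGroup
  haveI := ht.t2Space
  exact ⟨t, ⟨inferInstance, inferInstance⟩, hconv⟩

/-- For a `PT`-sequence the strongest topology exists, that is, `P(G | a)` is itself a `T₁`
paratopological group in which `a` converges to `0`, and it is finer than every other one. -/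
theorem isLeast_strongestParatopology {G : Type*} [AddCommGroup G] {a : ℕ → G}
    (ha : IsPTSequence a) :
    IsLeast (convergenceTopologies a) (strongestParatopology a) := by
  refine ⟨⟨⟨continuousAdd_sInf fun t ht => ht.1.continuousAdd, ?_⟩, ?_⟩, fun t ht => sInf_le ht⟩
  · obtain ⟨t, ht⟩ := ha
    exact t1Space_antitone (sInf_le (show t ∈ convergenceTopologies a from ht)) ht.1.t1Space
  · rw [strongestParatopology, nhds_sInf]
    simp only [tendsto_iInf]
    exact fun t ht => ht.2

/-- Two topologies on `X` are `T₁`-complementary: both are `T₁`, the sets open in both are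
exactly those of the cofinite topology, and together they generate the discrete topology `⊥`
(`τ ⊓ σ` is the topology generated by the union of `τ` and `σ`). -/
structure IsT1Complementary {X : Type*} (τ σ : TopologicalSpace X) : Prop where
  t1Space_left : @T1Space X τ
  t1Space_right : @T1Space X σ
  inter_eq_cofinite : ∀ U : Set X, (IsOpen[τ] U ∧ IsOpen[σ] U) ↔ (U = ∅ ∨ Uᶜ.Finite)
  sup_eq_discrete : τ ⊓ σ = ⊥

/-! Let `E` and `F` be the neighbourhood filters of 0 for `strongestParatopology a` and a supposed
complement `σ`. Only three facts are used: `E` contains a countable subgroup `H`, every infinite set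
closed for both topologies is all of `G`, and some `U ∈ E`, `V ∈ F` meet only in 0. Sums of open
sets are open for both topologies, which gives `U' + V' = G` for all `U' ∈ E`, `V' ∈ F`
(`eq_add_of_forall_closed`). A failure of continuity of negation at 0 in `σ` would yield a proper
infinite set closed for both, so `F` is stable under negation (`exists_neg_mem`). Hence each `U'`
meets every translate of each `V'`, and this contradicts transversality (`false_of_transversal`). -/

/-- The filter `F` has the properties of the neighbourhood filter of `0` in a Hausdorff
paratopological group topology on `G`. -/
structure IsSeparatedAddFilter {G : Type*} [AddCommGroup G] (F : Filter G) : Prop where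
  zero_mem : ∀ V ∈ F, (0 : G) ∈ V
  exists_add_subset : ∀ V ∈ F, ∃ V' ∈ F, ∀ x ∈ V', ∀ y ∈ V', x + y ∈ V
  exists_sub_ne : ∀ g : G, g ≠ 0 → ∃ V ∈ F, ∀ x ∈ V, ∀ y ∈ V, x - y ≠ g
  exists_open_subset : ∀ V ∈ F, ∃ V' ∈ F, V' ⊆ V ∧ ∀ x ∈ V', {v | x + v ∈ V'} ∈ F

/-- `S` is closed in the translation invariant topology determined by the filter `F` at `0`. -/
def IsTranslationClosed {G : Type*} [AddCommGroup G] (F : Filter G) (S : Set G) : Prop :=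
  ∀ x, x ∉ S → {v | x + v ∉ S} ∈ F

/-! ### Translation-invariant topologies and their filters at 0. -/

section Topology

variable {G : Type*} [AddCommGroup G]

theorem nhds_eq_map_add_left_nhds_zero (t : TopologicalSpace G) (h : @ContinuousAdd G t _)
    (x : G) : @nhds G t x = Filter.map (x + ·) (@nhds G t 0) := by
  let _ := t
  have := h
  have := (Homeomorph.addLeft x).map_nhds_eq 0
  simpa using this.symm

theorem isOpen_iff_translation_mem (t : TopologicalSpace G) (h : @ContinuousAdd G t _)
    (O : Set G) : IsOpen[t] O ↔ ∀ x ∈ O, {v | x + v ∈ O} ∈ @nhds G t 0 := by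
  rw [isOpen_iff_mem_nhds]
  refine forall₂_congr fun x _ => ?_
  rw [nhds_eq_map_add_left_nhds_zero t h x]
  rfl

theorem isOpen_compl_of_isTranslationClosed (t : TopologicalSpace G)
    (h : @ContinuousAdd G t _) {S : Set G}
    (hS : IsTranslationClosed (@nhds G t 0) S) : IsOpen[t] Sᶜ :=
  (isOpen_iff_translation_mem t h Sᶜ).2 fun x hx => hS x hx

theorem isSeparatedAddFilter_nhds_zero (t : TopologicalSpace G) (h : @ContinuousAdd G t _)
    (h2 : @T2Space G t) : IsSeparatedAddFilter (@nhds G t 0) := by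
  have hopen := isOpen_iff_translation_mem t h
  let _ := t
  have := h
  have := h2
  refine ⟨fun V hV => mem_of_mem_nhds hV, fun V hV => ?_, fun g hg => ?_, fun V hV => ?_⟩
  · obtain ⟨V', hV', hadd⟩ := exists_nhds_zero_half hV
    exact ⟨V', hV', hadd⟩
  · obtain ⟨A, B, hA, hB, h0, hgB, hAB⟩ := t2_separation hg
    refine ⟨B ∩ {v | g + v ∈ A}, Filter.inter_mem (hB.mem_nhds hgB) ?_, ?_⟩
    · exact (hopen A).1 hA g h0
    · rintro x ⟨hx, -⟩ y ⟨-, hy⟩ rfl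
      refine Set.disjoint_left.1 hAB ?_ hx
      simpa using hy
  · exact ⟨interior V, interior_mem_nhds.2 hV, interior_subset,
      (hopen _).1 isOpen_interior⟩

end Topology

/-! ### Sequences of neighbourhoods and accumulation points. -/

namespace IsSeparatedAddFilter

variable {G : Type*} [AddCommGroup G] {E F : Filter G}

theorem compl_singleton_mem (hF : IsSeparatedAddFilter F) {g : G} (hg : g ≠ 0) :
    {g}ᶜ ∈ F := by
  obtain ⟨V, hV, h⟩ := hF.exists_sub_ne g hg
  refine Filter.mem_of_superset hV fun x hx hxg => h x hx 0 (hF.zero_mem V hV) ?_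
  simpa using hxg

theorem exists_seq (hF : IsSeparatedAddFilter F) (B : ℕ → Set G) (hB : ∀ n, B n ∈ F)
    {S : Set G} (hS : S.Countable) :
    ∃ V : ℕ → Set G, (∀ n, V n ∈ F) ∧ (∀ n, V n ⊆ B n) ∧
      (∀ n, ∀ x ∈ V (n + 1), ∀ y ∈ V (n + 1), x + y ∈ V n) ∧
      ∀ g ∈ S, g ≠ 0 → ∃ n, ∀ x ∈ V n, ∀ y ∈ V n, x - y ≠ g := by
  obtain ⟨e, he⟩ : ∃ e : ℕ → G, S ⊆ Set.range e := by
    obtain ⟨e, he⟩ := (hS.insert 0).exists_eq_range (Set.insert_nonempty 0 S)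
    exact ⟨e, he ▸ Set.subset_insert 0 S⟩
  have step : ∀ (n : ℕ) (V : F.sets), ∃ V' : F.sets, (V' : Set G) ⊆ B (n + 1) ∧
      (∀ x ∈ (V' : Set G), ∀ y ∈ (V' : Set G), x + y ∈ (V : Set G)) ∧
      (e n ≠ 0 → ∀ x ∈ (V' : Set G), ∀ y ∈ (V' : Set G), x - y ≠ e n) := by
    rintro n ⟨V, hV⟩
    obtain ⟨V₁, h₁, hadd⟩ := hF.exists_add_subset V hV
    obtain ⟨V₂, h₂, hsub⟩ : ∃ V₂ ∈ F, e n ≠ 0 → ∀ x ∈ V₂, ∀ y ∈ V₂, x - y ≠ e n := by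
      by_cases h0 : e n = 0
      · exact ⟨Set.univ, Filter.univ_mem, fun h => absurd h0 h⟩
      · obtain ⟨V₂, h₂, h⟩ := hF.exists_sub_ne _ h0
        exact ⟨V₂, h₂, fun _ => h⟩
    refine ⟨⟨V₁ ∩ V₂ ∩ B (n + 1), Filter.inter_mem (Filter.inter_mem h₁ h₂) (hB _)⟩,
      fun x hx => hx.2, fun x hx y hy => hadd x hx.1.1 y hy.1.1,
      fun h0 x hx y hy => hsub h0 x hx.1.2 y hy.1.2⟩
  choose next hnextB hnext hnexte using step
  let V : ℕ → F.sets := fun n => Nat.rec ⟨B 0, hB 0⟩ (fun n V => next n V) n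
  let W : ℕ → Set G := fun n => (V n).1
  refine ⟨W, fun n => (V n).2, fun n => ?_, fun n => hnext n (V n), ?_⟩
  · cases n with
    | zero => exact subset_rfl
    | succ n => exact hnextB n (V n)
  · intro g hg hg0
    obtain ⟨n, rfl⟩ := he hg
    exact ⟨n + 1, hnexte n (V n) hg0⟩

/-- A sequence accumulating at most at `y` forms, together with `y`, a closed set. -/
theorem isTranslationClosed_insert_range (hF : IsSeparatedAddFilter F) {f : ℕ → G} {y : G}
    (h : ∀ x, x ≠ y → ∃ V ∈ F, {k | f k - x ∈ V}.Finite) :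
    IsTranslationClosed F (insert y (Set.range f)) := by
  intro x hx
  have hxy : x ≠ y := fun h => hx (h ▸ Set.mem_insert _ _)
  obtain ⟨V, hV, hfin⟩ := h x hxy
  have h1 : {y - x}ᶜ ∈ F := hF.compl_singleton_mem (sub_ne_zero.2 hxy.symm)
  have h2 : (⋂ k ∈ {k | f k - x ∈ V}, {f k - x}ᶜ) ∈ F := by
    refine (Filter.biInter_mem hfin).2 fun k _ => hF.compl_singleton_mem (sub_ne_zero.2 ?_)
    rintro rfl
    exact hx (Set.mem_insert_of_mem _ ⟨k, rfl⟩)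
  filter_upwards [hV, h1, h2] with v hv hv1 hv2
  rintro (hvy | ⟨k, hk⟩)
  · exact hv1 (by simp [← hvy])
  · have hkv : f k - x = v := by rw [hk]; abel
    have := Set.mem_iInter₂.1 hv2 k (by simpa [hkv] using hv)
    exact this hkv.symm

/-- Every sequence has a subsequence with at most one accumulation point, as soon as
some neighbourhood of `0` is a countable subgroup. -/
theorem exists_subseq (hE : IsSeparatedAddFilter E) {H : AddSubgroup G}
    (hHc : (H : Set G).Countable) (hHE : (H : Set G) ∈ E) (f : ℕ → G) :
    ∃ (φ : ℕ → ℕ) (y : G), StrictMono φ ∧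
      ∀ x, x ≠ y → ∃ V ∈ E, {k | f (φ k) - x ∈ V}.Finite := by
  obtain ⟨V, hV, hVH, hadd, hsep⟩ := hE.exists_seq (fun _ => H) (fun _ => hHE) hHc
  -- Differences give a base at 0 of a coarser first-countable Hausdorff group topology.
  let D : ℕ → Set G := fun n => {g | ∃ p ∈ V n, ∃ q ∈ V n, g = p - q}
  have hVD : ∀ n, V n ⊆ D n := fun n p hp =>
    ⟨p, hp, 0, hE.zero_mem _ (hV n), (sub_zero p).symm⟩
  have hD : ∀ n, D n ∈ E := fun n => Filter.mem_of_superset (hV n) (hVD n)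
  have hDsub : ∀ n, ∀ x ∈ D (n + 1), ∀ y ∈ D (n + 1), x - y ∈ D n := by
    rintro n _ ⟨p, hp, q, hq, rfl⟩ _ ⟨r, hr, s, hs, rfl⟩
    exact ⟨p + s, hadd n p hp s hs, q + r, hadd n q hq r hr, by abel⟩
  have hDanti : Antitone D := antitone_nat_of_succ_le fun n x hx => by
    simpa using hDsub n x hx 0 (hE.zero_mem _ (hD _))
  have hD0 : ∀ g, g ≠ 0 → ∃ n, g ∉ D n := by
    intro g hg
    by_cases hgH : g ∈ H
    · obtain ⟨n, hn⟩ := hsep g hgH hg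
      exact ⟨n, fun ⟨p, hp, q, hq, h⟩ => hn p hp q hq h.symm⟩
    · refine ⟨0, fun ⟨p, hp, q, hq, h⟩ => hgH ?_⟩
      rw [h]
      exact H.sub_mem (hVH 0 hp) (hVH 0 hq)
  -- If `y` is an accumulation point for the `D n`, some subsequence converges to it; otherwise
  -- there is none, and 0 is a dummy value.
  by_cases hy : ∃ y, ∀ n, {k | f k - y ∈ D n}.Infinite
  · obtain ⟨y, hy⟩ := hy
    obtain ⟨φ, hφ, hφD⟩ := Filter.extraction_forall_of_frequently
      (P := fun n k => f k - y ∈ D n) fun n => Nat.frequently_atTop_iff_infinite.2 (hy n)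
    refine ⟨φ, y, hφ, fun x hx => ?_⟩
    obtain ⟨n, hn⟩ := hD0 (x - y) (sub_ne_zero.2 hx)
    refine ⟨D (n + 1), hD _, (Set.finite_le_nat n).subset fun k hk => ?_⟩
    by_contra hkn
    refine hn ?_
    have := hDsub n _ (hDanti (Nat.succ_le_of_lt (not_le.1 hkn)) (hφD k)) _ hk
    simpa using this
  · push Not at hy
    refine ⟨id, 0, strictMono_id, fun x _ => ?_⟩
    obtain ⟨n, hn⟩ := hy x
    exact ⟨D n, hD n, by simpa using hn⟩

/-! ### Two filters with only trivial common closed sets. -/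

section Complementary

variable [Infinite G]

/-- A sum of open neighbourhoods is open for both topologies, hence cofinite, and in an infinite
group every element is a sum of two members of a cofinite set. -/
theorem eq_add_of_forall_closed (hE : IsSeparatedAddFilter E) (hF : IsSeparatedAddFilter F)
    (hEF : ∀ S, IsTranslationClosed E S → IsTranslationClosed F S → S.Infinite →
      S = Set.univ)
    {U V : Set G} (hU : U ∈ E) (hV : V ∈ F) (g : G) : ∃ u ∈ U, ∃ v ∈ V, g = u + v := by
  obtain ⟨U₁, hU₁, hUadd⟩ := hE.exists_add_subset U hU
  obtain ⟨V₁, hV₁, hVadd⟩ := hF.exists_add_subset V hV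
  obtain ⟨U₂, hU₂, hU₂₁, hUo⟩ := hE.exists_open_subset U₁ hU₁
  obtain ⟨V₂, hV₂, hV₂₁, hVo⟩ := hF.exists_open_subset V₁ hV₁
  let O : Set G := {g | ∃ u ∈ U₂, ∃ v ∈ V₂, g = u + v}
  have hO0 : (0 : G) ∈ O := ⟨0, hE.zero_mem _ hU₂, 0, hF.zero_mem _ hV₂, by simp⟩
  have hfin : Oᶜ.Finite := by
    by_contra hinf
    have := hEF Oᶜ ?_ ?_ hinf
    · exact (this ▸ Set.mem_univ (0 : G) : (0 : G) ∈ Oᶜ) hO0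
    · intro x hx
      obtain ⟨u, hu, v, hv, rfl⟩ := not_not.1 hx
      filter_upwards [hUo u hu] with w hw
      exact not_not.2 ⟨u + w, hw, v, hv, by abel⟩
    · intro x hx
      obtain ⟨u, hu, v, hv, rfl⟩ := not_not.1 hx
      filter_upwards [hVo v hv] with w hw
      exact not_not.2 ⟨u, hu, v + w, hw, by abel⟩
  have hfin' : ((g - ·) ⁻¹' Oᶜ).Finite := hfin.preimage (sub_right_injective.injOn)
  obtain ⟨x, hx⟩ := (hfin.union hfin').infinite_compl.nonempty
  rw [Set.mem_compl_iff, Set.mem_union, not_or] at hx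
  obtain ⟨u, hu, v, hv, h⟩ := not_not.1 hx.1
  obtain ⟨u', hu', v', hv', h'⟩ : g - x ∈ O := not_not.1 hx.2
  refine ⟨u + u', hUadd _ (hU₂₁ hu) _ (hU₂₁ hu'), v + v',
    hVadd _ (hV₂₁ hv) _ (hV₂₁ hv'), ?_⟩
  calc g = x + (g - x) := by abel
    _ = (u + v) + (u' + v') := by rw [h', h]
    _ = _ := by abel

/-- Inside every sequence of neighbourhoods there is one defining a Hausdorff topology. -/
theorem exists_separating_seq (hE : IsSeparatedAddFilter E) (hF : IsSeparatedAddFilter F)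
    (hEF : ∀ S, IsTranslationClosed E S → IsTranslationClosed F S → S.Infinite →
      S = Set.univ)
    {H : AddSubgroup G} (hHc : (H : Set G).Countable) (hHE : (H : Set G) ∈ E)
    {V : Set G} (hV : V ∈ F) :
    ∃ B : ℕ → Set G, (∀ n, B n ∈ F) ∧ (∀ n, B n ⊆ V) ∧
      (∀ n, ∀ x ∈ B (n + 1), ∀ y ∈ B (n + 1), x + y ∈ B n) ∧
      ∀ g, g ≠ 0 → ∃ n, ∀ x ∈ B n, ∀ y ∈ B n, x - y ≠ g := by
  -- Separating `g₀` as well keeps the subgroup `M` below proper, even when `H` is trivial.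
  obtain ⟨g₀, hg₀⟩ := exists_ne (0 : G)
  obtain ⟨A, hA, hAV, hadd, hsep⟩ := hF.exists_seq (fun _ => V) (fun _ => hV)
    (hHc.insert g₀)
  have h0 : ∀ n, (0 : G) ∈ A n := fun n => hF.zero_mem _ (hA n)
  let M : Set G := {g | ∀ n, ∃ p ∈ A n, ∃ q ∈ A n, g = p - q}
  have hMsub : ∀ x ∈ M, ∀ y ∈ M, x - y ∈ M := by
    intro x hx y hy n
    obtain ⟨p, hp, q, hq, rfl⟩ := hx (n + 1)
    obtain ⟨r, hr, s, hs, rfl⟩ := hy (n + 1)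
    exact ⟨p + s, hadd n p hp s hs, q + r, hadd n q hq r hr, by abel⟩
  have hMS : ∀ g ∈ M, g ∈ insert g₀ (H : Set G) → g = 0 := by
    intro g hg hgS
    by_contra hne
    obtain ⟨n, hn⟩ := hsep g hgS hne
    obtain ⟨p, hp, q, hq, h⟩ := hg n
    exact hn p hp q hq h.symm
  have hMF : IsTranslationClosed F M := by
    intro x hx
    obtain ⟨n, hn⟩ : ∃ n, ¬ ∃ p ∈ A n, ∃ q ∈ A n, x = p - q := not_forall.1 hx
    filter_upwards [hA (n + 1)] with v hv hxv
    obtain ⟨p, hp, q, hq, h⟩ := hxv (n + 1)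
    refine hn ⟨p, by simpa using hadd n p hp 0 (h0 _), q + v, hadd n q hq v hv, ?_⟩
    rw [← sub_sub, ← h]
    abel
  have hME : IsTranslationClosed E M := by
    intro x hx
    -- As `M ∩ H` is trivial, the coset `x + H` has at most one point of `M`, which a smaller
    -- neighbourhood avoids.
    by_cases hex : ∃ e ∈ H, x + e ∈ M
    · obtain ⟨e, heH, heM⟩ := hex
      have he0 : e ≠ 0 := by
        rintro rfl
        exact hx (by simpa using heM)
      filter_upwards [hHE, hE.compl_singleton_mem he0] with v hvH hve hvM
      refine hve (sub_eq_zero.1 (hMS (v - e) ?_ (Set.mem_insert_of_mem _ (H.sub_mem hvH heH))))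
      simpa using hMsub _ hvM _ heM
    · filter_upwards [hHE] with v hvH hvM
      exact hex ⟨v, hvH, hvM⟩
  have hMfin : M.Finite := by
    by_contra hinf
    have hM := hEF M hME hMF hinf
    exact hg₀ (hMS g₀ (hM ▸ Set.mem_univ g₀) (Set.mem_insert _ _))
  obtain ⟨B, hB, hBA, hBadd, hBsep⟩ := hF.exists_seq A hA hMfin.countable
  refine ⟨B, hB, fun n => (hBA n).trans (hAV n), hBadd, fun g hg => ?_⟩
  by_cases hgM : g ∈ M
  · exact hBsep g hgM hg
  · obtain ⟨n, hn⟩ : ∃ n, ¬ ∃ p ∈ A n, ∃ q ∈ A n, g = p - q := not_forall.1 hgM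
    exact ⟨n, fun x hx y hy h => hn ⟨x, hBA n hx, y, hBA n hy, h.symm⟩⟩

/-- Otherwise there are `x n → 0` (along the `B n`) with `-x n ∉ V`. The `-x n` have no accumulation
point for `F`, and a subsequence has at most one for `E`; adding that point makes it closed for
both. -/
theorem exists_neg_mem (hE : IsSeparatedAddFilter E) (hF : IsSeparatedAddFilter F)
    (hEF : ∀ S, IsTranslationClosed E S → IsTranslationClosed F S → S.Infinite →
      S = Set.univ)
    {H : AddSubgroup G} (hHc : (H : Set G).Countable) (hHE : (H : Set G) ∈ E)
    {V : Set G} (hV : V ∈ F) : ∃ V' ∈ F, ∀ x ∈ V', -x ∈ V := by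
  obtain ⟨B, hB, hBV, hadd, hsep⟩ := hE.exists_separating_seq hF hEF hHc hHE hV
  have h0 : ∀ n, (0 : G) ∈ B n := fun n => hF.zero_mem _ (hB n)
  have hanti : Antitone B := antitone_nat_of_succ_le fun n x hx => by
    simpa using hadd n x hx 0 (h0 _)
  by_contra! hcon
  choose x hxB hxV using fun n => hcon (B n) (hB n)
  have hacc : ∀ y, ∃ W ∈ F, {k | -x k - y ∈ W}.Finite := by
    intro y
    by_contra! hinf
    -- Adding `x k` to `-x k - y` puts `-y` in every `B n`.
    have hy : y = 0 := by
      by_contra hy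
      obtain ⟨n, hn⟩ := hsep (-y) (neg_ne_zero.2 hy)
      obtain ⟨k, hk, hnk⟩ := (hinf (B (n + 1)) (hB _)).exists_gt (n + 1)
      refine hn (-y) ?_ 0 (h0 n) (sub_zero _)
      have := hadd n _ (hanti hnk.le (hxB k)) _ hk
      rwa [show x k + (-x k - y) = -y by abel] at this
    subst hy
    obtain ⟨k, hk⟩ := (hinf V hV).nonempty
    exact hxV k (by simpa using hk)
  obtain ⟨φ, y, hφ, hφE⟩ := hE.exists_subseq hHc hHE (fun k => -x k)
  have hφF : ∀ z, ∃ W ∈ F, {k | -x (φ k) - z ∈ W}.Finite := fun z => by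
    obtain ⟨W, hW, hfin⟩ := hacc z
    exact ⟨W, hW, Set.Finite.preimage (f := φ) hφ.injective.injOn hfin⟩
  have hval : ∀ z, {k | -x (φ k) = z}.Finite := fun z => by
    obtain ⟨W, hW, hfin⟩ := hφF z
    refine hfin.subset fun k hk => ?_
    have hk' : -x (φ k) = z := hk
    simpa [hk'] using hF.zero_mem W hW
  obtain ⟨z, hz⟩ := exists_ne y
  obtain ⟨K, hK⟩ := (hval z).bddAbove
  -- Dropping the terms up to `K` removes every occurrence of `z`, so the closed set is proper.
  have hinj : Function.Injective (fun k : ℕ => k + (K + 1)) := add_left_injective _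
  let f : ℕ → G := fun k => -x (φ (k + (K + 1)))
  have hclE : IsTranslationClosed E (insert y (Set.range f)) :=
    hE.isTranslationClosed_insert_range fun w hw => by
      obtain ⟨W, hW, hfin⟩ := hφE w hw
      exact ⟨W, hW, Set.Finite.preimage (f := fun k => k + (K + 1)) hinj.injOn hfin⟩
  have hclF : IsTranslationClosed F (insert y (Set.range f)) :=
    hF.isTranslationClosed_insert_range fun w _ => by
      obtain ⟨W, hW, hfin⟩ := hφF w
      exact ⟨W, hW, Set.Finite.preimage (f := fun k => k + (K + 1)) hinj.injOn hfin⟩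
  have hinf : (Set.range f).Infinite := by
    intro hfin
    refine Set.infinite_univ (α := ℕ) ?_
    refine (hfin.biUnion fun w _ => (hval w).preimage hinj.injOn).subset fun k _ => ?_
    exact Set.mem_biUnion (Set.mem_range_self k) rfl
  have huniv := hEF _ hclE hclF (hinf.mono (Set.subset_insert _ _))
  have hzmem : z ∈ insert y (Set.range f) := huniv ▸ Set.mem_univ z
  rcases hzmem with h | ⟨k, hk⟩
  · exact hz h
  · have := hK (show k + (K + 1) ∈ {k | -x (φ k) = z} from hk)
    omega

/-- Transversal filters cannot have only trivial common closed sets if one of them contains a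
countable subgroup. -/
theorem false_of_transversal (hE : IsSeparatedAddFilter E) (hF : IsSeparatedAddFilter F)
    (hEF : ∀ S, IsTranslationClosed E S → IsTranslationClosed F S → S.Infinite →
      S = Set.univ)
    {H : AddSubgroup G} (hHc : (H : Set G).Countable) (hHE : (H : Set G) ∈ E)
    {U V : Set G} (hU : U ∈ E) (hV : V ∈ F) (hUV : U ∩ V ⊆ {0}) : False := by
  have hmeet : ∀ U' ∈ E, ∀ V' ∈ F, ∀ g, ∃ u ∈ U', u - g ∈ V' := by
    intro U' hU' V' hV' g
    obtain ⟨V'', hV'', hneg⟩ := hE.exists_neg_mem hF hEF hHc hHE hV'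
    obtain ⟨u, hu, v, hv, rfl⟩ := hE.eq_add_of_forall_closed hF hEF hU' hV'' g
    exact ⟨u, hu, by simpa using hneg v hv⟩
  obtain ⟨g, hg⟩ := exists_ne (0 : G)
  obtain ⟨U₁, hU₁, hUadd⟩ := hE.exists_add_subset U hU
  obtain ⟨V₁, hV₁, hVadd⟩ := hF.exists_add_subset V hV
  have hsum : ∀ u ∈ U₁, u - g ∈ V₁ → ∀ u' ∈ U₁, u' - -g ∈ V₁ → u + u' = 0 := by
    intro u hu hug u' hu' hug'
    refine hUV ⟨hUadd u hu u' hu', ?_⟩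
    have := hVadd _ hug _ hug'
    rwa [show u - g + (u' - -g) = u + u' by abel] at this
  obtain ⟨u, hu, hug⟩ := hmeet U₁ hU₁ (V₁ ∩ {-g}ᶜ)
    (Filter.inter_mem hV₁ (hF.compl_singleton_mem (neg_ne_zero.2 hg))) g
  obtain ⟨u', hu', hug'⟩ := hmeet U₁ hU₁ V₁ hV₁ (-g)
  have hu0 : u ≠ 0 := by
    rintro rfl
    exact hug.2 (by simp)
  -- By `hsum`, both `u` and `w` must equal `-u'`, yet `w` is chosen different from `u`.
  obtain ⟨w, hw, hwg⟩ := hmeet (U₁ ∩ {u}ᶜ)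
    (Filter.inter_mem hU₁ (hE.compl_singleton_mem hu0)) V₁ hV₁ g
  have h₁ := hsum u hu hug.1 u' hu' hug'
  have h₂ := hsum w hw.1 hwg u' hu' hug'
  exact hw.2 (add_right_cancel (h₂.trans h₁.symm))

end Complementary

end IsSeparatedAddFilter

/-! ### The strongest topology and the conclusion. -/

theorem t2Space_strongestParatopology {G : Type*} [AddCommGroup G] {a : ℕ → G}
    (ha : IsTSequence a) : @T2Space G (strongestParatopology a) := by
  obtain ⟨t, ht, hconv⟩ := ha
  have hmem : t ∈ convergenceTopologies a := by
    let _ := t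
    have := ht.isTopologicalAddGroup
    have := ht.t2Space
    exact ⟨⟨inferInstance, inferInstance⟩, hconv⟩
  exact t2Space_antitone (sInf_le hmem) ht.t2Space

/-- The subgroup generated by the sequence is open in `P(G | a)`. -/
theorem closure_range_mem_nhds_strongestParatopology {G : Type*} [AddCommGroup G] {a : ℕ → G}
    (ha : IsPTSequence a) :
    (AddSubgroup.closure (Set.range a) : Set G) ∈ @nhds G (strongestParatopology a) 0 := by
  obtain ⟨t, ht, hconv⟩ := ha
  set H := AddSubgroup.closure (Set.range a) with hH
  let d : TopologicalSpace (G ⧸ H) := ⊥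
  have : DiscreteTopology (G ⧸ H) := ⟨rfl⟩
  -- Pulled back from the discrete quotient, `c` makes `H` open and `a` converge to 0, so refining
  -- `t` by `c` stays among the competing topologies.
  let c : TopologicalSpace G := TopologicalSpace.induced (QuotientAddGroup.mk' H) d
  have hc : @ContinuousAdd G c _ := continuousAdd_induced (QuotientAddGroup.mk' H)
  have hHc : (H : Set G) ∈ @nhds G c 0 := by
    rw [nhds_induced, nhds_discrete]
    refine ⟨{0}, by simp, fun x hx => ?_⟩
    exact (QuotientAddGroup.eq_zero_iff x).1 (by simpa using hx)
  have hmem : t ⊓ c ∈ convergenceTopologies a := by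
    refine ⟨⟨continuousAdd_inf ht.continuousAdd hc,
      t1Space_antitone inf_le_left ht.t1Space⟩, ?_⟩
    rw [nhds_inf (t₁ := t) (t₂ := c), tendsto_inf]
    refine ⟨hconv, ?_⟩
    rw [nhds_induced, tendsto_comap_iff]
    refine tendsto_const_nhds.congr fun n => ?_
    have : (QuotientAddGroup.mk' H) (a n) = 0 :=
      (QuotientAddGroup.eq_zero_iff (a n)).2 (AddSubgroup.subset_closure ⟨n, rfl⟩)
    simp only [Function.comp_apply, this, map_zero]
  exact nhds_mono ((sInf_le hmem).trans inf_le_right) hHc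

theorem theorem5p16 {G : Type*} [AddCommGroup G] [Infinite G] (a : ℕ → G)
    (ha : IsTSequence a) :
    ¬ ∃ σ : TopologicalSpace G, IsHausdorffParatopologicalGroupTopology σ ∧
      IsT1Complementary (strongestParatopology a) σ := by
  rintro ⟨σ, hσ, hcomp⟩
  have hadd := (isLeast_strongestParatopology ha.isPTSequence).1.1.continuousAdd
  have hE := isSeparatedAddFilter_nhds_zero _ hadd (t2Space_strongestParatopology ha)
  have hF := isSeparatedAddFilter_nhds_zero σ hσ.continuousAdd hσ.t2Space
  have hcount : (AddSubgroup.closure (Set.range a) : Set G).Countable := by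
    rw [← Submodule.span_int_eq_addSubgroupClosure]
    exact (inferInstance : Countable (Submodule.span ℤ (Set.range a)))
  have hzero : ({0} : Set G) ∈ @nhds G (strongestParatopology a ⊓ σ) 0 := by
    rw [hcomp.sup_eq_discrete]
    let _ : TopologicalSpace G := ⊥
    have : DiscreteTopology G := ⟨rfl⟩
    simp
  rw [nhds_inf (t₁ := strongestParatopology a) (t₂ := σ)] at hzero
  obtain ⟨U, hU, V, hV, hUV⟩ := Filter.mem_inf_iff.1 hzero
  refine hE.false_of_transversal hF (fun S hSE hSF hinf => ?_) hcount
    (closure_range_mem_nhds_strongestParatopology ha.isPTSequence) hU hV hUV.ge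
  rcases (hcomp.inter_eq_cofinite Sᶜ).1
    ⟨isOpen_compl_of_isTranslationClosed _ hadd hSE,
      isOpen_compl_of_isTranslationClosed σ hσ.continuousAdd hSF⟩ with h | h
  · exact Set.compl_empty_iff.1 h
  · exact absurd (compl_compl S ▸ h) hinf
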